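/- Let $\Omega$ be a non-empty subset of $\mathbb{R}$ (equipped with the restriction of Lebesgue measure), let $d \in \mathbb{N}$, and let $\Psi : [0,\infty) \to [0,\infty)$ be a measurable function. For $p \in [1,\infty)$ let $W^{\Psi,p}(\Omega,\mathbb{R}^d)$ be the space of all $f \in L^p(\Omega,\mathbb{R}^d)$ such that $$[f]_{\Psi,p} := \left( \iint_{\Omega\times\Omega} \frac{\|f(s_2)-f(s_1)\|_{\mathbb{R}^d}^p}{\Psi(|s_2-s_1|)^p}\, \frac{1}{|s_2-s_1|}\, ds_2\, ds_1 \right)^{1/p} < \infty,$$ with the norm $\|f\|_{W^{\Psi,p}} := \|f\|_{L^p(\Omega)} + [f]_{\Psi,p}$. Where $\Psi$ vanishes, a quotient $c/0$ is read as $+\infty$ for $c > 0$, and a quotient with zero numerator and zero denominator is read as $0$. Let $q \in (1,\infty]$ satisfy $1/p + 1/q = 1$. Then for every continuous linear functional $T \in (W^{\Psi,p}(\Omega,\mathbb{R}^d))'$ there exists $(\phi,\psi) \in L^q(\Omega,\mathbb{R}^d) \times L^q(\Omega\times\Omega,\mathbb{R}^d)$ such that $$\|T\|_{(W^{\Psi,p}(\Omega,\mathbb{R}^d))'}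 = \max\{ \|\phi\|_{L^q(\Omega)}, \|\psi\|_{L^q(\Omega\times\Omega)} \}$$ and, for every $f \in W^{\Psi,p}(\Omega,\mathbb{R}^d)$, $$T(f) = \int_\Omega f(s)\cdot\phi(s)\, ds + \iint_{\Omega\times\Omega} \left( \frac{f(s_2)-f(s_1)}{\Psi(|s_2-s_1|)} \cdot \psi(s_1,s_2) \right) \frac{1}{|s_2-s_1|^{1/p}}\, ds_2\, ds_1 .$$ In particular, if $1 < p < \infty$, then $W^{\Psi,p}(\Omega,\mathbb{R}^d)$ is reflexive. -/

import Mathlib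

open MeasureTheory
open scoped NNReal ENNReal

noncomputable section

namespace PsiSobolev

/-- Lebesgue measurability of a function `Ψ : [0,∞) → [0,∞)`: almost everywhere equal, for the
Lebesgue measure on `[0,∞)`, to a Borel function. -/
def LebesgueMeasurable (Ψ : ℝ≥0 → ℝ≥0) : Prop :=
  AEMeasurable Ψ ((volume : Measure ℝ).comap ((↑) : ℝ≥0 → ℝ))

/-- The integrand `‖f(s₂) - f(s₁)‖^p / Ψ(|s₂ - s₁|)^p * 1 / |s₂ - s₁|` at `z = (s₁, s₂)`, with values
in `[0,∞]`. Here `a / 0 = ∞` for `a > 0`, and `0 / 0 = 0`. -/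
def psiIntegrand {d : ℕ} (Ψ : ℝ≥0 → ℝ≥0) (p : ℝ≥0) (f : ℝ → EuclideanSpace ℝ (Fin d))
    (z : ℝ × ℝ) : ℝ≥0∞ :=
  ‖f z.2 - f z.1‖ₑ ^ (p : ℝ) / (Ψ ‖z.2 - z.1‖₊ : ℝ≥0∞) ^ (p : ℝ) * (1 / ‖z.2 - z.1‖ₑ)

/-- The seminorm `[f]_{Ψ,p}`, with values in `[0,∞]`. -/
def psiSeminorm {d : ℕ} (Ψ : ℝ≥0 → ℝ≥0) (p : ℝ≥0) (Ω : Set ℝ)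
    (f : ℝ → EuclideanSpace ℝ (Fin d)) : ℝ≥0∞ :=
  (∫⁻ z in Ω ×ˢ Ω, psiIntegrand Ψ p f z) ^ (1 / (p : ℝ))

section Lemmas

variable {d : ℕ} {Ψ : ℝ≥0 → ℝ≥0} {p : ℝ≥0} {Ω : Set ℝ}

theorem LebesgueMeasurable.comp_nnnorm_sub (hΨ : LebesgueMeasurable Ψ) :
    AEMeasurable (fun z : ℝ × ℝ => Ψ ‖z.2 - z.1‖₊) (volume : Measure (ℝ × ℝ)) := by
  have h1 : Measure.QuasiMeasurePreserving (fun x : ℝ => ‖x‖₊) volume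
      ((volume : Measure ℝ).comap ((↑) : ℝ≥0 → ℝ)) := by
    refine ⟨measurable_nnnorm, ?_⟩
    refine Measure.AbsolutelyContinuous.mk fun s hs h0 => ?_
    rw [Measure.map_apply measurable_nnnorm hs]
    have he : MeasurableEmbedding ((↑) : ℝ≥0 → ℝ) :=
      MeasurableEmbedding.subtype_coe measurableSet_Ici
    rw [he.comap_apply] at h0
    have h2 : volume (-(((↑) : ℝ≥0 → ℝ) '' s)) = 0 := by
      rw [Measure.measure_neg, h0]
    refine measure_mono_null ?_ (measure_union_null h0 h2)
    intro x hx
    rcases le_total 0 x with h | h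
    · left
      exact ⟨‖x‖₊, hx, by simp [abs_of_nonneg h]⟩
    · right
      exact ⟨‖x‖₊, hx, by simp [abs_of_nonpos h]⟩
  have h2 : Measure.QuasiMeasurePreserving (fun z : ℝ × ℝ => z.1 - z.2)
      (volume : Measure (ℝ × ℝ)) volume := quasiMeasurePreserving_sub volume volume
  have h3 := AEMeasurable.comp_quasiMeasurePreserving hΨ (h1.comp h2)
  refine h3.congr (Filter.Eventually.of_forall fun z => ?_)
  simp only [Function.comp]
  rw [← nnnorm_neg, neg_sub]

/-- The `p`-th root of `psiIntegrand`. -/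
def psiRoot (Ψ : ℝ≥0 → ℝ≥0) (p : ℝ≥0) (f : ℝ → EuclideanSpace ℝ (Fin d))
    (z : ℝ × ℝ) : ℝ≥0∞ :=
  ‖f z.2 - f z.1‖ₑ / (Ψ ‖z.2 - z.1‖₊ : ℝ≥0∞) * (1 / ‖z.2 - z.1‖ₑ) ^ (1 / (p : ℝ))

theorem psiIntegrand_eq (hp : 1 ≤ p) (f : ℝ → EuclideanSpace ℝ (Fin d)) (z : ℝ × ℝ) :
    psiIntegrand Ψ p f z = psiRoot Ψ p f z ^ (p : ℝ) := by
  have h0 : (p : ℝ) ≠ 0 := by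
    have : (1 : ℝ) ≤ p := by exact_mod_cast hp
    positivity
  rw [psiIntegrand, psiRoot, ENNReal.mul_rpow_of_nonneg _ _ p.coe_nonneg,
    ENNReal.div_rpow_of_nonneg _ _ p.coe_nonneg, ← ENNReal.rpow_mul, one_div_mul_cancel h0,
    ENNReal.rpow_one]

theorem psiRoot_add_le (f g : ℝ → EuclideanSpace ℝ (Fin d)) (z : ℝ × ℝ) :
    psiRoot Ψ p (f + g) z ≤ psiRoot Ψ p f z + psiRoot Ψ p g z := by
  simp only [psiRoot]
  rw [← add_mul, ← ENNReal.add_div]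
  gcongr
  have : (f + g) z.2 - (f + g) z.1 = (f z.2 - f z.1) + (g z.2 - g z.1) := by
    simp only [Pi.add_apply]; abel
  rw [this]
  exact enorm_add_le _ _

theorem aestronglyMeasurable_comp_fst_snd {f : ℝ → EuclideanSpace ℝ (Fin d)}
    (hf : AEStronglyMeasurable f (volume.restrict Ω)) :
    AEStronglyMeasurable (fun z : ℝ × ℝ => f z.1) (volume.restrict (Ω ×ˢ Ω)) ∧
      AEStronglyMeasurable (fun z : ℝ × ℝ => f z.2) (volume.restrict (Ω ×ˢ Ω)) := by
  rw [Measure.volume_eq_prod, ← Measure.prod_restrict]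
  exact ⟨hf.comp_fst, hf.comp_snd⟩

theorem aemeasurable_psiRoot (hΨ : LebesgueMeasurable Ψ) {f : ℝ → EuclideanSpace ℝ (Fin d)}
    (hf : AEStronglyMeasurable f (volume.restrict Ω)) :
    AEMeasurable (psiRoot Ψ p f) (volume.restrict (Ω ×ˢ Ω)) := by
  obtain ⟨h1, h2⟩ := aestronglyMeasurable_comp_fst_snd hf
  have h3 : AEMeasurable (fun z : ℝ × ℝ => ((Ψ ‖z.2 - z.1‖₊ : ℝ≥0) : ℝ≥0∞))
      (volume.restrict (Ω ×ˢ Ω)) := hΨ.comp_nnnorm_sub.coe_nnreal_ennreal.restrict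
  refine ((h2.sub h1).enorm.div h3).mul ?_
  fun_prop

theorem psiSeminorm_congr {f g : ℝ → EuclideanSpace ℝ (Fin d)}
    (h : f =ᵐ[volume.restrict Ω] g) : psiSeminorm Ψ p Ω f = psiSeminorm Ψ p Ω g := by
  unfold psiSeminorm
  congr 1
  apply lintegral_congr_ae
  have h1 : (fun z : ℝ × ℝ => f z.1) =ᵐ[volume.restrict (Ω ×ˢ Ω)] fun z => g z.1 := by
    rw [Measure.volume_eq_prod, ← Measure.prod_restrict]
    exact Measure.quasiMeasurePreserving_fst.ae_eq_comp h
  have h2 : (fun z : ℝ × ℝ => f z.2) =ᵐ[volume.restrict (Ω ×ˢ Ω)] fun z => g z.2 := by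
    rw [Measure.volume_eq_prod, ← Measure.prod_restrict]
    exact Measure.quasiMeasurePreserving_snd.ae_eq_comp h
  filter_upwards [h1, h2] with z hz1 hz2
  simp only [psiIntegrand]
  rw [hz1, hz2]

theorem psiSeminorm_add_le (hp : 1 ≤ p) (hΨ : LebesgueMeasurable Ψ)
    {f g : ℝ → EuclideanSpace ℝ (Fin d)}
    (hf : AEStronglyMeasurable f (volume.restrict Ω))
    (hg : AEStronglyMeasurable g (volume.restrict Ω)) :
    psiSeminorm Ψ p Ω (f + g) ≤ psiSeminorm Ψ p Ω f + psiSeminorm Ψ p Ω g := by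
  simp only [psiSeminorm, psiIntegrand_eq hp]
  refine le_trans ?_ (ENNReal.lintegral_Lp_add_le (aemeasurable_psiRoot hΨ hf)
    (aemeasurable_psiRoot hΨ hg) (by exact_mod_cast hp))
  gcongr with z
  exact psiRoot_add_le f g z

theorem psiSeminorm_smul (hp : 1 ≤ p) (c : ℝ) (f : ℝ → EuclideanSpace ℝ (Fin d)) :
    psiSeminorm Ψ p Ω (c • f) = ‖c‖ₑ * psiSeminorm Ψ p Ω f := by
  have h0 : (p : ℝ) ≠ 0 := by
    have : (1 : ℝ) ≤ p := by exact_mod_cast hp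
    positivity
  have h : ∀ z, psiIntegrand Ψ p (c • f) z = ‖c‖ₑ ^ (p : ℝ) * psiIntegrand Ψ p f z := by
    intro z
    simp only [psiIntegrand, Pi.smul_apply, ← smul_sub, enorm_smul]
    rw [ENNReal.mul_rpow_of_nonneg _ _ p.coe_nonneg, mul_div_assoc, mul_assoc]
  simp only [psiSeminorm, h]
  rw [lintegral_const_mul' _ _ (ENNReal.rpow_ne_top_of_nonneg p.coe_nonneg enorm_ne_top),
    ENNReal.mul_rpow_of_nonneg _ _ (by positivity), ← ENNReal.rpow_mul, mul_one_div_cancel h0,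
    ENNReal.rpow_one]

theorem psiSeminorm_zero (hp : 1 ≤ p) :
    psiSeminorm Ψ p Ω (0 : ℝ → EuclideanSpace ℝ (Fin d)) = 0 := by
  simpa using psiSeminorm_smul (Ψ := Ψ) (Ω := Ω) hp 0 (0 : ℝ → EuclideanSpace ℝ (Fin d))

end Lemmas

/-- `L^r(Ω, ℝ^d)`, for the Lebesgue measure restricted to `Ω ⊆ ℝ`. -/
abbrev LpOn (r : ℝ≥0∞) (Ω : Set ℝ) (d : ℕ) :=
  Lp (EuclideanSpace ℝ (Fin d)) r ((volume : Measure ℝ).restrict Ω)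

/-- `L^r(Ω × Ω, ℝ^d)`, for the Lebesgue measure of `ℝ × ℝ` restricted to `Ω × Ω`. -/
abbrev LpOnProd (r : ℝ≥0∞) (Ω : Set ℝ) (d : ℕ) :=
  Lp (EuclideanSpace ℝ (Fin d)) r ((volume : Measure (ℝ × ℝ)).restrict (Ω ×ˢ Ω))

theorem one_le_of_fact (p : ℝ≥0) [h : Fact (1 ≤ (p : ℝ≥0∞))] : 1 ≤ p := by
  exact_mod_cast h.out

/-- The functions of `L^p(Ω, ℝ^d)` with `[f]_{Ψ,p} < ∞`, as a linear subspace. -/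
def WSubmodule (Ψ : ℝ≥0 → ℝ≥0) (hΨ : LebesgueMeasurable Ψ) (p : ℝ≥0) [Fact (1 ≤ (p : ℝ≥0∞))]
    (Ω : Set ℝ) (d : ℕ) : Submodule ℝ (LpOn p Ω d) where
  carrier := {f | psiSeminorm Ψ p Ω f < ∞}
  zero_mem' := by
    have h := Lp.coeFn_zero (EuclideanSpace ℝ (Fin d)) (p : ℝ≥0∞) (volume.restrict Ω)
    rw [Set.mem_ofPred_eq, psiSeminorm_congr h, psiSeminorm_zero (one_le_of_fact p)]
    exact ENNReal.zero_lt_top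
  add_mem' := by
    intro f g hf hg
    rw [Set.mem_ofPred_eq, psiSeminorm_congr (Lp.coeFn_add f g)]
    exact (psiSeminorm_add_le (one_le_of_fact p) hΨ (Lp.aestronglyMeasurable f)
      (Lp.aestronglyMeasurable g)).trans_lt (ENNReal.add_lt_top.2 ⟨hf, hg⟩)
  smul_mem' := by
    intro c f hf
    rw [Set.mem_ofPred_eq, psiSeminorm_congr (Lp.coeFn_smul c f),
      psiSeminorm_smul (one_le_of_fact p)]
    exact ENNReal.mul_lt_top enorm_lt_top hf

/-- The space `W^{Ψ,p}(Ω, ℝ^d)`. It is a type synonym of `WSubmodule`, because its norm is not the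
norm of `L^p`. -/
def W (Ψ : ℝ≥0 → ℝ≥0) (hΨ : LebesgueMeasurable Ψ) (p : ℝ≥0) [Fact (1 ≤ (p : ℝ≥0∞))]
    (Ω : Set ℝ) (d : ℕ) : Type :=
  WSubmodule Ψ hΨ p Ω d

namespace W

variable {Ψ : ℝ≥0 → ℝ≥0} {hΨ : LebesgueMeasurable Ψ} {p : ℝ≥0} [Fact (1 ≤ (p : ℝ≥0∞))]
  {Ω : Set ℝ} {d : ℕ}

instance : AddCommGroup (W Ψ hΨ p Ω d) :=
  inferInstanceAs (AddCommGroup (WSubmodule Ψ hΨ p Ω d))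

instance : Module ℝ (W Ψ hΨ p Ω d) :=
  inferInstanceAs (Module ℝ (WSubmodule Ψ hΨ p Ω d))

/-- The inclusion of `W^{Ψ,p}(Ω, ℝ^d)` into `L^p(Ω, ℝ^d)`. -/
def toLp : W Ψ hΨ p Ω d →ₗ[ℝ] LpOn p Ω d := (WSubmodule Ψ hΨ p Ω d).subtype

theorem toLp_injective : Function.Injective (toLp : W Ψ hΨ p Ω d → LpOn p Ω d) :=
  Subtype.val_injective

/-- An element of `W^{Ψ,p}(Ω, ℝ^d)` as a function (a representative of its class). -/
instance : CoeFun (W Ψ hΨ p Ω d) fun _ => ℝ → EuclideanSpace ℝ (Fin d) :=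
  ⟨fun f => (toLp f : ℝ → EuclideanSpace ℝ (Fin d))⟩

theorem psiSeminorm_lt_top (f : W Ψ hΨ p Ω d) : psiSeminorm Ψ p Ω f < ∞ := f.2

/-- The norm `‖f‖_{L^p} + [f]_{Ψ,p}`. -/
instance : Norm (W Ψ hΨ p Ω d) :=
  ⟨fun f => ‖toLp f‖ + (psiSeminorm Ψ p Ω f).toReal⟩

theorem norm_def (f : W Ψ hΨ p Ω d) : ‖f‖ = ‖toLp f‖ + (psiSeminorm Ψ p Ω f).toReal := rfl

theorem core : NormedSpace.Core ℝ (W Ψ hΨ p Ω d) where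
  norm_nonneg f := add_nonneg (norm_nonneg _) ENNReal.toReal_nonneg
  norm_smul c f := by
    rw [norm_def, norm_def, map_smul, norm_smul, psiSeminorm_congr (Lp.coeFn_smul c (toLp f)),
      psiSeminorm_smul (one_le_of_fact p), ENNReal.toReal_mul, toReal_enorm, mul_add]
  norm_triangle f g := by
    have h : (psiSeminorm Ψ p Ω (f + g : W Ψ hΨ p Ω d)).toReal
        ≤ (psiSeminorm Ψ p Ω f).toReal + (psiSeminorm Ψ p Ω g).toReal := by
      rw [← ENNReal.toReal_add (psiSeminorm_lt_top f).ne (psiSeminorm_lt_top g).ne]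
      refine ENNReal.toReal_mono
        (ENNReal.add_ne_top.2 ⟨(psiSeminorm_lt_top f).ne, (psiSeminorm_lt_top g).ne⟩) ?_
      rw [map_add, psiSeminorm_congr (Lp.coeFn_add (toLp f) (toLp g))]
      exact psiSeminorm_add_le (one_le_of_fact p) hΨ (Lp.aestronglyMeasurable _)
        (Lp.aestronglyMeasurable _)
    have h' := norm_add_le (toLp f) (toLp g)
    rw [norm_def, norm_def, norm_def]
    rw [map_add] at h ⊢
    linarith
  norm_eq_zero_iff f := by
    constructor
    · intro h
      have h1 : ‖toLp f‖ = 0 := by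
        have := norm_nonneg (toLp f)
        have h2 : 0 ≤ (psiSeminorm Ψ p Ω f).toReal := ENNReal.toReal_nonneg
        rw [norm_def] at h
        linarith
      exact toLp_injective (by rw [norm_eq_zero.1 h1, map_zero])
    · rintro rfl
      rw [norm_def, map_zero, norm_zero, psiSeminorm_congr (Lp.coeFn_zero _ _ _),
        psiSeminorm_zero (one_le_of_fact p)]
      simp

instance : NormedAddCommGroup (W Ψ hΨ p Ω d) := NormedAddCommGroup.ofCore core

instance : NormedSpace ℝ (W Ψ hΨ p Ω d) := NormedSpace.ofCore core

end W

/-- A real normed space is reflexive if the canonical map into its bidual is surjective. -/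
def IsReflexive (X : Type*) [NormedAddCommGroup X] [NormedSpace ℝ X] : Prop :=
  Function.Surjective (NormedSpace.inclusionInDoubleDual ℝ X)

end PsiSobolev

end

/-!
The map `f ↦ (f, Df)`, where `Df(s₁, s₂) = (f(s₂) - f(s₁)) / (Ψ(|s₂ - s₁|) |s₂ - s₁|^(1/p))`, is a
linear isometry of `W^{Ψ,p}(Ω, ℝ^d)` into the `ℓ¹` sum of `L^p(Ω, ℝ^d)` and `L^p(Ω × Ω, ℝ^d)`
(`PsiSobolev.W.graph`). By Hahn–Banach a functional on `W^{Ψ,p}` extends to the `ℓ¹` sum with the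
same norm; there it splits into a functional on each summand, and its norm is the larger of the two
norms. The Riesz representation theorem for `L^p`, `1 ≤ p < ∞`, turns the two functionals into the
functions `φ` and `ψ`.

If `1 < p < ∞`, the Riesz theorem for `p` and for `q` makes both `L^p` spaces reflexive, hence also
their `ℓ¹` sum. The range of the embedding is closed
(`PsiSobolev.W.isClosed_range_graph`), and closed subspaces of reflexive spaces are reflexive.

The value `0` that Lean gives to `Df` where `Ψ` vanishes is harmless: a function of finite seminorm
satisfies `f(s₁) = f(s₂)` at almost every such pair, and this passes to limits.

The Riesz theorem (`MeasureTheory.Lp.exists_forall_apply_eq_integral_inner`) is proved for functions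
with values in a finite-dimensional inner product space over a `σ`-finite measure `μ`. With a
positive weight `w ∈ L^p(μ)`, the set functions `A ↦ T(1_A w b)`, for `b` in an orthonormal basis,
are signed measures absolutely continuous with respect to `μ`. Their Radon–Nikodym densities, divided
by `w`, form a function `g` with `T(w s) = ∫ ⟪w s, g⟫` for simple `s`. Approximation of `f / w` by
simple functions extends this to all `f ∈ L^p` with `‖f‖ ‖g‖` integrable; the converse of Hölder's
inequality then gives `‖g‖_q ≤ ‖T‖`, and so the formula holds on all of `L^p`.
-/

noncomputable section

namespace MeasureTheory

open Filter Topology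

variable {α E : Type*} [MeasurableSpace α] {μ : Measure α} {p q : ℝ≥0∞} [NormedAddCommGroup E]

/-! ### Dominated convergence and `L^p`-valued measures -/

/-- Dominated convergence in `L^p`, for `p < ∞`. -/
theorem tendsto_eLpNorm_sub_of_dominated {ι : Type*} {l : Filter ι} [l.IsCountablyGenerated]
    (hp0 : p ≠ 0) (hp : p ≠ ∞) {F : ι → α → E} {f G : α → E} (hG : MemLp G p μ) (C : ℝ)
    (hF : ∀ n, AEStronglyMeasurable (F n) μ) (hf : AEStronglyMeasurable f μ)
    (bound : ∀ n x, ‖F n x - f x‖ ≤ C * ‖G x‖)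
    (lim : ∀ x, Tendsto (fun n => F n x) l (𝓝 (f x))) :
    Tendsto (fun n => eLpNorm (F n - f) p μ) l (𝓝 0) := by
  have hpos : 0 < p.toReal := ENNReal.toReal_pos hp0 hp
  have hCG : MemLp (fun x => C * ‖G x‖) p μ := hG.norm.const_mul C
  have key : Tendsto (fun n => ∫⁻ x, ‖(F n - f) x‖ₑ ^ p.toReal ∂μ) l (𝓝 (∫⁻ _, 0 ∂μ)) := by
    refine tendsto_lintegral_filter_of_dominated_convergence'
      (fun x => ‖C * ‖G x‖‖ₑ ^ p.toReal) ?_ ?_ ?_ ?_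
    · exact Eventually.of_forall fun n => ((hF n).sub hf).enorm.pow_const _
    · refine Eventually.of_forall fun n => ae_of_all _ fun x => ?_
      refine ENNReal.rpow_le_rpow ?_ hpos.le
      refine enorm_le_iff_norm_le.2 ?_
      exact (bound n x).trans (le_abs_self _)
    · exact (lintegral_rpow_enorm_lt_top_of_eLpNorm_lt_top hp0 hp hCG.2).ne
    · refine ae_of_all _ fun x => ?_
      have h1 : Tendsto (fun n => ‖(F n - f) x‖ₑ) l (𝓝 0) := by
        have := ((lim x).sub_const (f x)).enorm
        simpa using this
      simpa [ENNReal.zero_rpow_of_pos hpos] using h1.ennrpow_const p.toReal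
  simp only [eLpNorm_eq_lintegral_rpow_enorm_toReal hp0 hp]
  have := key.ennrpow_const (1 / p.toReal)
  simpa [ENNReal.zero_rpow_of_pos (inv_pos.2 hpos)] using this

/-- The `L^p`-valued measure `A ↦ 1_A f` of a function `f ∈ L^p`, `p < ∞`. -/
def Lp.indicatorVectorMeasure [Fact (1 ≤ p)] (hp : p ≠ ∞) (f : Lp E p μ) :
    VectorMeasure α (Lp E p μ) where
  measureOf' A := open Classical in
    if hA : MeasurableSet A then ((Lp.memLp f).indicator hA).toLp else 0
  empty' := by
    rw [dif_pos MeasurableSet.empty]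
    simp [Set.indicator_empty]
    rfl
  not_measurable' A hA := dif_neg hA
  m_iUnion' A hA hd := by
    rw [dif_pos (MeasurableSet.iUnion hA), HasSum]
    have h (s : Finset ℕ) : ∑ i ∈ s, (open Classical in
        if hA : MeasurableSet (A i) then ((Lp.memLp f).indicator hA).toLp else 0) =
        ((Lp.memLp f).indicator (s.measurableSet_biUnion fun i _ => hA i)).toLp := by
      classical
      induction s using Finset.induction_on with
      | empty => simp [Set.indicator_empty]; rfl
      | insert a s ha ih =>
        rw [Finset.sum_insert ha, ih, dif_pos (hA a), ← MemLp.toLp_add]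
        refine MemLp.toLp_congr _ _ (ae_of_all _ fun x => ?_)
        rw [Finset.set_biUnion_insert, Set.indicator_union_of_disjoint]
        · rfl
        · rw [Set.disjoint_iUnion₂_right]
          exact fun i hi => hd (by rintro rfl; exact ha hi)
    simp only [SummationFilter.unconditional_filter, h]
    rw [Lp.tendsto_Lp_iff_tendsto_eLpNorm'']
    refine tendsto_eLpNorm_sub_of_dominated (zero_lt_one.trans_le Fact.out).ne' hp (Lp.memLp f) 1
      (fun s => ((Lp.memLp f).indicator (s.measurableSet_biUnion fun i _ => hA i)).1)
      ((Lp.memLp f).indicator (MeasurableSet.iUnion hA)).1 ?_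
      fun x => (tendsto_indicator_biUnion_finset A _ x).mono_right (pure_le_nhds _)
    intro s x
    by_cases h1 : x ∈ ⋃ i ∈ s, A i
    · have h2 : x ∈ ⋃ i, A i := by
        simp only [Set.mem_iUnion] at h1 ⊢
        obtain ⟨i, _, hi⟩ := h1
        exact ⟨i, hi⟩
      simp [h1, h2]
    · rw [Set.indicator_of_notMem h1, zero_sub, _root_.norm_neg, one_mul]
      exact norm_indicator_le_norm_self _ _

theorem Lp.indicatorVectorMeasure_apply [Fact (1 ≤ p)] (hp : p ≠ ∞) (f : Lp E p μ)
    {A : Set α} (hA : MeasurableSet A) :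
    Lp.indicatorVectorMeasure hp f A = ((Lp.memLp f).indicator hA).toLp :=
  dif_pos hA

/-! ### The converse of Hölder's inequality -/

variable [InnerProductSpace ℝ E]

theorem exists_pos_memLp [SigmaFinite μ] (hp0 : p ≠ 0) (hp : p ≠ ∞) :
    ∃ w : α → ℝ, Measurable w ∧ (∀ x, 0 < w x) ∧ MemLp w p μ := by
  obtain ⟨g, hg0, hgm, hg⟩ := exists_pos_lintegral_lt_of_sigmaFinite μ one_ne_zero
  have hpos : 0 < p.toReal := ENNReal.toReal_pos hp0 hp
  have hm : Measurable fun x => (g x : ℝ) ^ (1 / p.toReal) := by fun_prop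
  refine ⟨fun x => (g x : ℝ) ^ (1 / p.toReal), hm,
    fun x => Real.rpow_pos_of_pos (hg0 x) _, hm.aestronglyMeasurable, ?_⟩
  refine (eLpNorm_lt_top_iff_lintegral_rpow_enorm_lt_top hp0 hp).2 ?_
  refine (lintegral_congr fun x => ?_).trans_lt (hg.trans ENNReal.one_lt_top)
  rw [← ofReal_norm, Real.norm_of_nonneg (by positivity),
    ENNReal.ofReal_rpow_of_nonneg (by positivity) hpos.le, ← Real.rpow_mul (by positivity),
    one_div_mul_cancel hpos.ne', Real.rpow_one, ENNReal.ofReal_coe_nnreal]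

/-- The converse of Hölder's inequality for `1 < p < ∞`, tested against the truncations of
`‖g‖^(q-2) g`. -/
theorem eLpNorm_le_of_integral_inner_le_of_ne_top [SigmaFinite μ] [ENNReal.HolderConjugate p q]
    (hp : p ≠ ∞) (hq : q ≠ ∞) {g : α → E} (hg : StronglyMeasurable g) {C : ℝ} (hC : 0 ≤ C)
    (h : ∀ f : α → E, MemLp f p μ → Integrable (fun x => ‖f x‖ * ‖g x‖) μ →
      |∫ x, inner ℝ (f x) (g x) ∂μ| ≤ C * (eLpNorm f p μ).toReal) :
    eLpNorm g q μ ≤ ENNReal.ofReal C := by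
  have hc : p.toReal.HolderConjugate q.toReal := ENNReal.HolderConjugate.toReal_of_ne_top hp hq
  set r := q.toReal with hr
  set s := p.toReal with hs
  have hr1 : 1 < r := hc.symm.lt
  have hr0 : 0 < r := zero_lt_one.trans hr1
  have hs0 : 0 < s := zero_lt_one.trans hc.lt
  have hrs : (r - 1) * s = r := hc.symm.sub_one_mul_conj
  have hp0 : p ≠ 0 := ENNReal.HolderConjugate.ne_zero p q
  have hq0 : q ≠ 0 := ENNReal.HolderConjugate.ne_zero q p
  -- On `A n`, of finite measure, `g` is bounded, so the test functions below are admissible.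
  set A : ℕ → Set α := fun n => spanningSets μ n ∩ {x | ‖g x‖ ≤ n} with hA
  have hAm n : MeasurableSet (A n) :=
    (measurableSet_spanningSets μ n).inter (hg.norm.measurable measurableSet_Iic)
  have hAfin n : μ (A n) < ∞ :=
    (measure_mono Set.inter_subset_left).trans_lt (measure_spanningSets_lt_top μ n)
  have hAmono : Monotone A := fun m n hmn =>
    Set.inter_subset_inter (monotone_spanningSets μ hmn) fun x hx =>
      le_trans (α := ℝ) hx (Nat.cast_le.2 hmn)
  have hAU : ⋃ n, A n = Set.univ := by
    refine Set.eq_univ_of_forall fun x => Set.mem_iUnion.2 ?_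
    obtain ⟨m, hm⟩ := Set.mem_iUnion.1 ((iUnion_spanningSets μ).symm ▸ Set.mem_univ x)
    obtain ⟨n, hn⟩ := exists_nat_ge ‖g x‖
    refine ⟨max m n, monotone_spanningSets μ (le_max_left m n) hm, hn.trans ?_⟩
    exact Nat.cast_le.2 (le_max_right m n)
  have hnorm (x : α) : ‖‖g x‖ ^ (r - 2) • g x‖ = ‖g x‖ ^ (r - 1) := by
    rw [norm_smul, Real.norm_of_nonneg (by positivity)]
    rcases eq_or_ne ‖g x‖ 0 with h0 | h0
    · rw [h0, mul_zero, Real.zero_rpow (by linarith)]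
    · rw [← Real.rpow_add_one h0]
      congr 1
      ring
  have hpow (x : α) : ENNReal.ofReal (‖g x‖ ^ r) = ‖g x‖ₑ ^ r := by
    rw [← ENNReal.ofReal_rpow_of_nonneg (norm_nonneg _) hr0.le, ofReal_norm]
  have key (n : ℕ) : ∫⁻ x in A n, ‖g x‖ₑ ^ r ∂μ ≤ ENNReal.ofReal (C ^ r) := by
    have : IsFiniteMeasure (μ.restrict (A n)) := ⟨by simpa using hAfin n⟩
    set f : α → E := (A n).indicator fun x => ‖g x‖ ^ (r - 2) • g x with hf
    have hfm : StronglyMeasurable fun x => ‖g x‖ ^ (r - 2) • g x :=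
      (hg.norm.measurable.pow_const _).stronglyMeasurable.smul hg
    have hfp : MemLp f p μ := by
      rw [hf, memLp_indicator_iff_restrict (hAm n)]
      refine MemLp.of_bound hfm.aestronglyMeasurable ((n : ℝ) ^ (r - 1)) ?_
      filter_upwards [ae_restrict_mem (hAm n)] with x hx
      rw [hnorm]
      exact Real.rpow_le_rpow (norm_nonneg _) hx.2 (by linarith)
    have hfg : (fun x => ‖f x‖ * ‖g x‖) = (A n).indicator fun x => ‖g x‖ ^ r := by
      ext x
      by_cases hx : x ∈ A n
      · rw [hf, Set.indicator_of_mem hx, Set.indicator_of_mem hx, hnorm,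
          ← Real.rpow_add_one' (norm_nonneg _) (by linarith), sub_add_cancel]
      · simp [hf, hx]
    have hinner : (fun x => inner ℝ (f x) (g x)) = (A n).indicator fun x => ‖g x‖ ^ r := by
      rw [← hfg]
      ext x
      by_cases hx : x ∈ A n
      · rw [hf, Set.indicator_of_mem hx, real_inner_smul_left, real_inner_self_eq_norm_sq,
          norm_smul, Real.norm_of_nonneg (by positivity)]
        ring
      · simp [hf, hx]
    have hint : Integrable (fun x => ‖f x‖ * ‖g x‖) μ := by
      rw [hfg, integrable_indicator_iff (hAm n)]
      refine Integrable.of_bound (hg.norm.measurable.pow_const _).aestronglyMeasurable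
        ((n : ℝ) ^ r) ?_
      filter_upwards [ae_restrict_mem (hAm n)] with x hx
      rw [Real.norm_of_nonneg (by positivity)]
      exact Real.rpow_le_rpow (norm_nonneg _) hx.2 hr0.le
    set I := ∫⁻ x in A n, ‖g x‖ₑ ^ r ∂μ with hI
    have hI1 : ∫ x, inner ℝ (f x) (g x) ∂μ = I.toReal := by
      rw [hinner, integral_indicator (hAm n), integral_eq_lintegral_of_nonneg_ae
        (ae_of_all _ fun x => by positivity)
        (hg.norm.measurable.pow_const _).aestronglyMeasurable]
      simp only [hpow]
      rfl
    have hI2 : eLpNorm f p μ = I ^ (1 / s) := by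
      rw [eLpNorm_eq_lintegral_rpow_enorm_toReal hp0 hp, hI, ← lintegral_indicator (hAm n)]
      congr 2
      ext x
      by_cases hx : x ∈ A n
      · rw [hf, Set.indicator_of_mem hx, Set.indicator_of_mem hx, ← ofReal_norm, hnorm,
          ENNReal.ofReal_rpow_of_nonneg (by positivity) hs0.le,
          ← Real.rpow_mul (norm_nonneg _), hrs, hpow]
      · simp [hf, hx, ← hs, hs0]
    have hItop : I ≠ ∞ := by
      have h1 := hfp.eLpNorm_ne_top
      rw [hI2] at h1
      intro h2
      rw [h2, ENNReal.top_rpow_of_pos (by positivity)] at h1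
      exact h1 rfl
    -- The hypothesis reads `I ≤ C * I ^ (1 / p)`; dividing by the finite `I ^ (1 / p)` bounds `I`.
    have h1 := h f hfp hint
    rw [hI1, hI2, abs_of_nonneg ENNReal.toReal_nonneg, ← ENNReal.toReal_rpow] at h1
    rw [← ENNReal.ofReal_toReal hItop]
    refine ENNReal.ofReal_le_ofReal ?_
    set t := I.toReal
    rcases (ENNReal.toReal_nonneg : 0 ≤ t).eq_or_lt with h0 | h0
    · exact h0.symm.trans_le (by positivity)
    · have h2 : t = t ^ (1 / r) * t ^ (1 / s) := by
        rw [← Real.rpow_add h0, one_div, one_div, hc.symm.inv_add_inv_eq_one, Real.rpow_one]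
      have h3 : t ^ (1 / r) ≤ C := by
        refine le_of_mul_le_mul_right (h2 ▸ h1 : t ^ (1 / r) * t ^ (1 / s) ≤ _) (by positivity)
      calc t = (t ^ (1 / r)) ^ r := by
            rw [← Real.rpow_mul h0.le, one_div_mul_cancel hr0.ne', Real.rpow_one]
        _ ≤ C ^ r := Real.rpow_le_rpow (by positivity) h3 hr0.le
  have htot : ∫⁻ x, ‖g x‖ₑ ^ r ∂μ ≤ ENNReal.ofReal (C ^ r) := by
    rw [← setLIntegral_univ, ← hAU, setLIntegral_iUnion_of_directed _ hAmono.directed_le]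
    exact iSup_le key
  rw [eLpNorm_eq_lintegral_rpow_enorm_toReal hq0 hq, ← hr]
  calc _ ≤ (ENNReal.ofReal (C ^ r)) ^ (1 / r) := by gcongr
    _ = ENNReal.ofReal C := by
      rw [← ENNReal.ofReal_rpow_of_nonneg hC hr0.le, ← ENNReal.rpow_mul,
        mul_one_div_cancel hr0.ne', ENNReal.rpow_one]

/-- The converse of Hölder's inequality for `p = 1`: a set of positive measure on which
`‖g‖ > C` would be detected by `g / ‖g‖`. -/
theorem eLpNorm_top_le_of_integral_inner_le [SigmaFinite μ]
    {g : α → E} (hg : StronglyMeasurable g) {C : ℝ} (hC : 0 ≤ C)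
    (h : ∀ f : α → E, MemLp f 1 μ → Integrable (fun x => ‖f x‖ * ‖g x‖) μ →
      |∫ x, inner ℝ (f x) (g x) ∂μ| ≤ C * (eLpNorm f 1 μ).toReal) :
    eLpNorm g ∞ μ ≤ ENNReal.ofReal C := by
  rw [eLpNorm_exponent_top]
  refine eLpNormEssSup_le_of_ae_bound ?_
  set A : ℕ → Set α := fun n => spanningSets μ n ∩ {x | C < ‖g x‖ ∧ ‖g x‖ ≤ n} with hA
  have hAm n : MeasurableSet (A n) :=
    (measurableSet_spanningSets μ n).inter (hg.norm.measurable measurableSet_Ioc)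
  have hAfin n : μ (A n) < ∞ :=
    (measure_mono Set.inter_subset_left).trans_lt (measure_spanningSets_lt_top μ n)
  have key (n : ℕ) : μ (A n) = 0 := by
    have : IsFiniteMeasure (μ.restrict (A n)) := ⟨by simpa using hAfin n⟩
    set f : α → E := (A n).indicator fun x => ‖g x‖⁻¹ • g x with hf
    have hnorm : ∀ x ∈ A n, ‖‖g x‖⁻¹ • g x‖ = 1 := fun x hx => by
      have : ‖g x‖ ≠ 0 := (hC.trans_lt hx.2.1).ne'
      rw [norm_smul, norm_inv, norm_norm, inv_mul_cancel₀ this]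
    have hfm : StronglyMeasurable fun x => ‖g x‖⁻¹ • g x :=
      hg.norm.measurable.inv.stronglyMeasurable.smul hg
    have hfp : MemLp f 1 μ := by
      rw [hf, memLp_indicator_iff_restrict (hAm n)]
      refine MemLp.of_bound hfm.aestronglyMeasurable 1 ?_
      filter_upwards [ae_restrict_mem (hAm n)] with x hx
      rw [hnorm x hx]
    have hgi : IntegrableOn (fun x => ‖g x‖) (A n) μ := by
      refine Integrable.of_bound hg.norm.aestronglyMeasurable (n : ℝ) ?_
      filter_upwards [ae_restrict_mem (hAm n)] with x hx
      rw [norm_norm]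
      exact hx.2.2
    have hfg : (fun x => ‖f x‖ * ‖g x‖) = (A n).indicator fun x => ‖g x‖ := by
      ext x
      by_cases hx : x ∈ A n
      · rw [hf, Set.indicator_of_mem hx, Set.indicator_of_mem hx, hnorm x hx, one_mul]
      · simp [hf, hx]
    have hinner : (fun x => inner ℝ (f x) (g x)) = (A n).indicator fun x => ‖g x‖ := by
      rw [← hfg]
      ext x
      by_cases hx : x ∈ A n
      · rw [hf, Set.indicator_of_mem hx, real_inner_smul_left, real_inner_self_eq_norm_sq,
          norm_smul, Real.norm_of_nonneg (by positivity)]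
        ring
      · simp [hf, hx]
    have hf1 : eLpNorm f 1 μ = μ (A n) := by
      rw [eLpNorm_one_eq_lintegral_enorm, ← lintegral_indicator_one (hAm n)]
      congr 1
      ext x
      by_cases hx : x ∈ A n
      · rw [hf, Set.indicator_of_mem hx, Set.indicator_of_mem hx, ← ofReal_norm, hnorm x hx]
        simp
      · simp [hf, hx]
    have h1 := h f hfp (by rwa [hfg, integrable_indicator_iff (hAm n)])
    rw [hinner, integral_indicator (hAm n), hf1] at h1
    have h2 : ∫ x in A n, (‖g x‖ - C) ∂μ ≤ 0 := by
      rw [integral_sub hgi (integrable_const _), setIntegral_const, smul_eq_mul, mul_comm]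
      exact sub_nonpos.2 ((le_abs_self _).trans h1)
    have h3 := setIntegral_pos_iff_support_of_nonneg_ae (μ := μ) (s := A n)
      (f := fun x => ‖g x‖ - C) (by
        filter_upwards [ae_restrict_mem (hAm n)] with x hx
        exact sub_nonneg.2 hx.2.1.le) (hgi.sub (integrable_const _))
    have h4 : Function.support (fun x => ‖g x‖ - C) ∩ A n = A n :=
      Set.inter_eq_right.2 fun x hx => (sub_pos.2 hx.2.1).ne'
    rw [h4] at h3
    exact nonpos_iff_eq_zero.1 (not_lt.1 fun h5 => h2.not_gt (h3.2 h5))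
  rw [ae_iff]
  refine measure_mono_null ?_ (measure_iUnion_null key)
  intro x hx
  obtain ⟨m, hm⟩ := Set.mem_iUnion.1 ((iUnion_spanningSets μ).symm ▸ Set.mem_univ x)
  obtain ⟨n, hn⟩ := exists_nat_ge ‖g x‖
  exact Set.mem_iUnion.2 ⟨max m n, monotone_spanningSets μ (le_max_left m n) hm,
    not_le.1 hx, hn.trans (Nat.cast_le.2 (le_max_right m n))⟩

theorem eLpNorm_le_of_integral_inner_le [SigmaFinite μ] [hpq : ENNReal.HolderConjugate p q]
    (hp : p ≠ ∞) {g : α → E} (hg : StronglyMeasurable g) {C : ℝ} (hC : 0 ≤ C)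
    (h : ∀ f : α → E, MemLp f p μ → Integrable (fun x => ‖f x‖ * ‖g x‖) μ →
      |∫ x, inner ℝ (f x) (g x) ∂μ| ≤ C * (eLpNorm f p μ).toReal) :
    eLpNorm g q μ ≤ ENNReal.ofReal C := by
  rcases eq_or_ne q ∞ with hq | hq
  · have hp1 : p = 1 := by
      have := hpq.symm
      exact (ENNReal.HolderConjugate.eq_top_iff_eq_one q p).1 hq
    subst hq hp1
    exact eLpNorm_top_le_of_integral_inner_le hg hC h
  · exact eLpNorm_le_of_integral_inner_le_of_ne_top hp hq hg hC h

/-! ### The Riesz representation theorem for `L^p` -/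

/-- Radon–Nikodym: a functional on `L^p`, weighted by a positive `w ∈ L^p`, is given on simple
functions by an integrable density. -/
theorem exists_integrable_forall_simpleFunc [Fact (1 ≤ p)] [SigmaFinite μ]
    [FiniteDimensional ℝ E] (hp : p ≠ ∞)
    (T : StrongDual ℝ (Lp E p μ)) {w : α → ℝ} (hw : MemLp w p μ) :
    ∃ k : α → E, Integrable k μ ∧ ∀ (s : SimpleFunc α E) (h : MemLp (fun x => w x • s x) p μ),
      T h.toLp = ∫ x, inner ℝ (s x) (k x) ∂μ := by
  set b := stdOrthonormalBasis ℝ E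
  have hwc (c : E) : MemLp (fun x => w x • c) p μ := by
    refine hw.of_le_mul (c := ‖c‖) (hw.1.smul_const c) (ae_of_all _ fun x => ?_)
    rw [norm_smul, mul_comm]
  obtain ⟨ν, hνT⟩ : ∃ ν : Fin (Module.finrank ℝ E) → SignedMeasure α, ∀ i {A : Set α}
      (hA : MeasurableSet A), ν i A = T ((hwc (b i)).indicator hA).toLp := by
    refine ⟨fun i => (Lp.indicatorVectorMeasure hp (hwc (b i)).toLp).mapRange
      (T : Lp E p μ →+ ℝ) T.continuous, fun i A hA => ?_⟩
    change T (Lp.indicatorVectorMeasure hp (hwc (b i)).toLp A) = _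
    rw [Lp.indicatorVectorMeasure_apply hp _ hA]
    refine congrArg T (MemLp.toLp_congr _ _ ?_)
    filter_upwards [(hwc (b i)).coeFn_toLp] with x hx
    by_cases hxA : x ∈ A
    · rw [Set.indicator_of_mem hxA, Set.indicator_of_mem hxA, hx]
    · rw [Set.indicator_of_notMem hxA, Set.indicator_of_notMem hxA]
  have hac i : ν i ≪ᵥ μ.toENNRealVectorMeasure := by
    refine VectorMeasure.AbsolutelyContinuous.mk fun A hA h0 => ?_
    rw [Measure.toENNRealVectorMeasure_apply_measurable hA] at h0
    have hz : MemLp (0 : α → E) p μ := MemLp.zero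
    have h1 : ((hwc (b i)).indicator hA).toLp = 0 :=
      (MemLp.toLp_congr _ hz (indicator_meas_zero h0)).trans (MemLp.toLp_zero _)
    rw [hνT i hA, h1, map_zero]
  have hki i : Integrable ((ν i).rnDeriv μ) μ := SignedMeasure.integrable_rnDeriv _ _
  obtain ⟨k, hk⟩ : ∃ k : α → E, ∀ x, k x = ∑ i, (ν i).rnDeriv μ x • b i := ⟨_, fun _ => rfl⟩
  have hkint : Integrable k μ := by
    rw [funext hk]
    exact integrable_finsetSum _ fun i _ => (hki i).smul_const _
  have hset i {A : Set α} (hA : MeasurableSet A) :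
      T ((hwc (b i)).indicator hA).toLp = ∫ x in A, (ν i).rnDeriv μ x ∂μ := by
    rw [← hνT i hA, ← withDensityᵥ_apply (hki i) hA,
      SignedMeasure.withDensityᵥ_rnDeriv_eq _ _ (hac i)]
  have hws (s : SimpleFunc α E) : MemLp (fun x => w x • s x) p μ := by
    obtain ⟨C, hC⟩ := s.exists_forall_norm_le
    refine hw.of_le_mul (c := C) (hw.1.smul s.aestronglyMeasurable) (ae_of_all _ fun x => ?_)
    rw [norm_smul, mul_comm]
    exact mul_le_mul_of_nonneg_right (hC x) (norm_nonneg _)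
  have hsk (s : SimpleFunc α E) : Integrable (fun x => inner ℝ (s x) (k x)) μ := by
    obtain ⟨C, hC⟩ := s.exists_forall_norm_le
    refine (hkint.norm.const_mul C).mono' (s.aestronglyMeasurable.inner hkint.1)
      (ae_of_all _ fun x => ?_)
    exact (norm_inner_le_norm _ _).trans (mul_le_mul_of_nonneg_right (hC x) (norm_nonneg _))
  refine ⟨k, hkint, fun s => ?_⟩
  induction s using SimpleFunc.induction with
  | const c hA =>
    rename_i A
    intro h
    -- Both sides are linear in the value `c`, so a basis suffices.
    set Φ : E →ₗ[ℝ] ℝ :=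
      { toFun := fun c => T ((hwc c).indicator hA).toLp
        map_add' := fun c c' => by
          rw [← map_add, ← MemLp.toLp_add]
          refine congrArg T (MemLp.toLp_congr _ _ (ae_of_all _ fun x => ?_))
          by_cases hx : x ∈ A <;> simp [hx, smul_add]
        map_smul' := fun r c => by
          rw [RingHom.id_apply, ← map_smul, ← MemLp.toLp_const_smul]
          refine congrArg T (MemLp.toLp_congr _ _ (ae_of_all _ fun x => ?_))
          simp only [Pi.smul_apply, ← Set.indicator_const_smul_apply, smul_comm r] }
    have hΦ : Φ = innerₗ E (∫ x in A, k x ∂μ) := by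
      refine b.toBasis.ext fun i => ?_
      rw [OrthonormalBasis.coe_toBasis, innerₗ_apply_apply, real_inner_comm,
        ← integral_inner hkint.integrableOn]
      refine (hset i hA).trans (integral_congr_ae (ae_of_all _ fun x => ?_))
      exact (hk x ▸ b.orthonormal.inner_right_fintype _ i).symm
    have h1 : T h.toLp = Φ c := by
      refine congrArg T (MemLp.toLp_congr _ _ (ae_of_all _ fun x => ?_))
      by_cases hx : x ∈ A <;> simp [hx]
    rw [h1, hΦ, innerₗ_apply_apply, real_inner_comm, ← integral_inner hkint.integrableOn,
      ← integral_indicator hA]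
    refine integral_congr_ae (ae_of_all _ fun x => ?_)
    by_cases hx : x ∈ A <;> simp [hx]
  | add hd hf hg =>
    rename_i f g
    intro h
    have h1 : h.toLp = (hws f).toLp + (hws g).toLp := by
      rw [← MemLp.toLp_add]
      exact MemLp.toLp_congr _ _ (ae_of_all _ fun x => by simp)
    rw [h1, map_add, hf, hg, ← integral_add (hsk f) (hsk g)]
    simp [inner_add_left]

/-- A functional on `L^p` represented by a density `g` on the functions `w s`, `s` simple, is
represented by `g` on every `f ∈ L^p` for which `‖f‖ ‖g‖` is integrable: approximate `f / w` by
simple functions. -/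
theorem apply_eq_integral_inner_of_simpleFunc [Fact (1 ≤ p)] [FiniteDimensional ℝ E] (hp : p ≠ ∞)
    (T : StrongDual ℝ (Lp E p μ)) {w : α → ℝ} (hwm : Measurable w) (hw : ∀ x, 0 < w x)
    {g : α → E} (hg : StronglyMeasurable g)
    (hT : ∀ (s : SimpleFunc α E) (h : MemLp (fun x => w x • s x) p μ),
      T h.toLp = ∫ x, inner ℝ (w x • s x) (g x) ∂μ)
    {f : α → E} (hf : MemLp f p μ) (hfg : Integrable (fun x => ‖f x‖ * ‖g x‖) μ) :
    T hf.toLp = ∫ x, inner ℝ (f x) (g x) ∂μ := by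
  borelize E
  wlog hfm : StronglyMeasurable f generalizing f
  · have h1 := hf.1.ae_eq_mk
    have h2 := this ((memLp_congr_ae h1).1 hf)
      (hfg.congr (by filter_upwards [h1] with x hx; rw [← hx])) hf.1.stronglyMeasurable_mk
    rw [MemLp.toLp_congr hf ((memLp_congr_ae h1).1 hf) h1, h2]
    exact integral_congr_ae (by filter_upwards [h1] with x hx; rw [← hx])
  have hm : Measurable fun x => (w x)⁻¹ • f x := hwm.inv.smul hfm.measurable
  set s : ℕ → SimpleFunc α E := SimpleFunc.approxOn _ hm Set.univ 0 (Set.mem_univ _) with hs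
  set F : ℕ → α → E := fun n x => w x • s n x with hF
  have hFm n : StronglyMeasurable (F n) :=
    hwm.stronglyMeasurable.smul (s n).stronglyMeasurable
  have hbound n x : ‖F n x‖ ≤ 2 * ‖f x‖ := by
    have h1 := SimpleFunc.norm_approxOn_zero_le hm (Set.mem_univ _) x n
    rw [norm_smul (w x)⁻¹, norm_inv, ← two_mul] at h1
    have h2 : 0 < ‖w x‖ := norm_pos_iff.2 (hw x).ne'
    calc ‖F n x‖ = ‖w x‖ * ‖s n x‖ := norm_smul _ _
      _ ≤ ‖w x‖ * (2 * (‖w x‖⁻¹ * ‖f x‖)) := by gcongr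
      _ = 2 * ‖f x‖ := by field_simp
  have hlim x : Tendsto (fun n => F n x) atTop (𝓝 (f x)) := by
    have h1 := (SimpleFunc.tendsto_approxOn hm (Set.mem_univ (0 : E)) (x := x)
      (by simp)).const_smul (w x)
    rwa [smul_inv_smul₀ (hw x).ne'] at h1
  have hFp n : MemLp (F n) p μ :=
    hf.of_le_mul (hFm n).aestronglyMeasurable (ae_of_all _ (hbound n))
  have h1 : Tendsto (fun n => T (hFp n).toLp) atTop (𝓝 (T hf.toLp)) := by
    refine (T.continuous.tendsto _).comp ?_
    rw [Lp.tendsto_Lp_iff_tendsto_eLpNorm'']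
    -- `‖F n - f‖ ≤ ‖F n‖ + ‖f‖ ≤ 3 ‖f‖`
    refine tendsto_eLpNorm_sub_of_dominated (zero_lt_one.trans_le Fact.out).ne' hp hf 3
      (fun n => (hFp n).1) hf.1 (fun n x => ?_) hlim
    linarith [norm_sub_le (F n x) (f x), hbound n x]
  have h2 : Tendsto (fun n => T (hFp n).toLp) atTop (𝓝 (∫ x, inner ℝ (f x) (g x) ∂μ)) := by
    rw [funext fun n => hT (s n) (hFp n)]
    refine tendsto_integral_of_dominated_convergence (fun x => 2 * (‖f x‖ * ‖g x‖))
      (fun n => (hFm n).aestronglyMeasurable.inner hg.aestronglyMeasurable) (hfg.const_mul 2)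
      (fun n => ae_of_all _ fun x => ?_) (ae_of_all _ fun x => ?_)
    · rw [← mul_assoc]
      exact (norm_inner_le_norm _ _).trans
        (mul_le_mul_of_nonneg_right (hbound n x) (norm_nonneg _))
    · exact (hlim x).inner tendsto_const_nhds
  exact tendsto_nhds_unique h1 h2

theorem integrable_norm_mul_norm {F : Type*} [NormedAddCommGroup F] [ENNReal.HolderConjugate p q]
    {f g : α → F} (hf : MemLp f p μ) (hg : MemLp g q μ) : Integrable (fun x => ‖f x‖ * ‖g x‖) μ :=
  hf.norm.integrable_mul hg.norm

theorem Lp.abs_integral_inner_le [hpq : ENNReal.HolderConjugate p q] (f : Lp E p μ) (g : Lp E q μ) :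
    |∫ x, inner ℝ (f x) (g x) ∂μ| ≤ ‖g‖ * ‖f‖ := by
  have h : eLpNorm (fun x => inner ℝ (f x) (g x)) 1 μ ≤ eLpNorm f p μ * eLpNorm g q μ := by
    have := eLpNorm_le_eLpNorm_mul_eLpNorm_of_nnnorm (r := 1) (p := p) (q := q) (Lp.memLp f).1 (Lp.memLp g).1
      (fun x y => inner ℝ x y) 1 (ae_of_all _ fun x => by
        simpa using nnnorm_inner_le_nnnorm (𝕜 := ℝ) (f x) (g x))
    simpa using this
  rw [← Real.norm_eq_abs, Lp.norm_def, Lp.norm_def, mul_comm, ← ENNReal.toReal_mul, ← toReal_enorm]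
  refine ENNReal.toReal_mono (ENNReal.mul_ne_top (Lp.eLpNorm_ne_top f) (Lp.eLpNorm_ne_top g)) ?_
  refine (enorm_integral_le_lintegral_enorm _).trans ?_
  rwa [← eLpNorm_one_eq_lintegral_enorm]

/-- **Riesz representation theorem** for the dual of `L^p(μ, E)`, `1 ≤ p < ∞`. -/
theorem Lp.exists_forall_apply_eq_integral_inner [Fact (1 ≤ p)] [SigmaFinite μ]
    [FiniteDimensional ℝ E] [hpq : ENNReal.HolderConjugate p q] (hp : p ≠ ∞) (T : StrongDual ℝ (Lp E p μ)) :
    ∃ φ : Lp E q μ, ‖T‖ = ‖φ‖ ∧ ∀ f, T f = ∫ x, inner ℝ (f x) (φ x) ∂μ := by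
  have := hpq.symm
  have : Fact (1 ≤ q) := ⟨ENNReal.HolderConjugate.one_le q p⟩
  have hp0 : p ≠ 0 := (zero_lt_one.trans_le Fact.out).ne'
  obtain ⟨w, hwm, hw, hwp⟩ := exists_pos_memLp (μ := μ) hp0 hp
  obtain ⟨k, hk, hTk⟩ := exists_integrable_forall_simpleFunc hp T hwp
  set g : α → E := fun x => (w x)⁻¹ • hk.1.mk k x with hg
  have hgm : StronglyMeasurable g :=
    hwm.inv.stronglyMeasurable.smul hk.1.stronglyMeasurable_mk
  have hTg := fun f (hf : MemLp f p μ) => apply_eq_integral_inner_of_simpleFunc (f := f) hp T hwm hw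
    hgm (fun s h => by
      rw [hTk s h]
      refine integral_congr_ae ?_
      filter_upwards [hk.1.ae_eq_mk] with x hx
      rw [hg, real_inner_smul_left, real_inner_smul_right, mul_inv_cancel_left₀ (hw x).ne', ← hx])
    hf
  have hgq : eLpNorm g q μ ≤ ENNReal.ofReal ‖T‖ := by
    refine eLpNorm_le_of_integral_inner_le hp hgm (norm_nonneg T) fun f hf hfg => ?_
    rw [← hTg f hf hfg, ← Lp.norm_toLp f hf]
    exact T.le_opNorm _
  have hgL : MemLp g q μ := ⟨hgm.aestronglyMeasurable, hgq.trans_lt ENNReal.ofReal_lt_top⟩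
  have hrep (f : Lp E p μ) : T f = ∫ x, inner ℝ (f x) (hgL.toLp g x) ∂μ := by
    have h1 := hTg f (Lp.memLp f) (integrable_norm_mul_norm (Lp.memLp f) hgL)
    rw [Lp.toLp_coeFn] at h1
    rw [h1]
    refine integral_congr_ae ?_
    filter_upwards [hgL.coeFn_toLp] with x hx
    rw [hx]
  refine ⟨hgL.toLp, le_antisymm ?_ ?_, hrep⟩
  · refine T.opNorm_le_bound (norm_nonneg (hgL.toLp g)) fun f => ?_
    rw [hrep]
    exact Lp.abs_integral_inner_le f _
  · rw [Lp.norm_toLp]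
    exact ENNReal.toReal_le_of_le_ofReal (norm_nonneg T) hgq

theorem Lp.exists_strictMono_tendsto_ae {F : Type*} [NormedAddCommGroup F] {r : ℝ≥0∞}
    [Fact (1 ≤ r)] {f : ℕ → Lp F r μ} {g : Lp F r μ} (h : Tendsto f atTop (𝓝 g)) :
    ∃ ns : ℕ → ℕ, StrictMono ns ∧ ∀ᵐ x ∂μ, Tendsto (fun i => f (ns i) x) atTop (𝓝 (g x)) :=
  (tendstoInMeasure_of_tendsto_Lp h).exists_seq_tendsto_ae

end MeasureTheory

namespace PsiSobolev

open Filter Topology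

/-! ### Extension of functionals and reflexivity -/

section NormedSpace

variable {X Y Z : Type*} [NormedAddCommGroup X] [NormedSpace ℝ X] [NormedAddCommGroup Y]
  [NormedSpace ℝ Y] [NormedAddCommGroup Z] [NormedSpace ℝ Z]

/-- Hahn–Banach: a functional extends along an isometric embedding without increasing its norm. -/
theorem exists_extension_along_isometry (J : X →ₗᵢ[ℝ] Y) (T : StrongDual ℝ X) :
    ∃ S : StrongDual ℝ Y, (∀ x, S (J x) = T x) ∧ ‖S‖ = ‖T‖ := by
  set e := J.equivRange with he
  obtain ⟨S, hS, hn⟩ := exists_extension_norm_eq (LinearMap.range J.toLinearMap)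
    (T.comp (e.symm.toContinuousLinearEquiv : _ →L[ℝ] X))
  have hSJ x : S (J x) = T x := by
    have h1 := hS (e x)
    simpa [he] using h1
  refine ⟨S, hSJ, le_antisymm ?_ ?_⟩
  · rw [hn]
    refine ContinuousLinearMap.opNorm_le_bound _ (norm_nonneg T) fun y => ?_
    have h1 := T.le_opNorm (e.symm y)
    rwa [e.symm.norm_map] at h1
  · refine T.opNorm_le_bound (norm_nonneg S) fun x => ?_
    rw [← hSJ, ← J.norm_map x]
    exact S.le_opNorm _

theorem exists_apply_withLp_one_prod_eq (S : StrongDual ℝ (WithLp 1 (X × Y))) :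
    ∃ (S₁ : StrongDual ℝ X) (S₂ : StrongDual ℝ Y), ∀ z, S z = S₁ z.fst + S₂ z.snd := by
  set e := (WithLp.prodContinuousLinearEquiv 1 ℝ X Y).symm
  refine ⟨(S.comp (e : X × Y →L[ℝ] _)).comp (.inl ℝ X Y),
    (S.comp (e : X × Y →L[ℝ] _)).comp (.inr ℝ X Y), fun z => ?_⟩
  simp only [ContinuousLinearMap.comp_apply, ← map_add]
  refine congrArg S ?_
  simp [e]
  rfl

/-- The dual norm of the `ℓ¹` sum is the maximum of the two dual norms. -/
theorem norm_eq_max_of_apply_withLp_one_prod {S : StrongDual ℝ (WithLp 1 (X × Y))}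
    {S₁ : StrongDual ℝ X} {S₂ : StrongDual ℝ Y} (h : ∀ z, S z = S₁ z.fst + S₂ z.snd) :
    ‖S‖ = max ‖S₁‖ ‖S₂‖ := by
  refine le_antisymm ?_ (max_le ?_ ?_)
  · refine S.opNorm_le_bound (le_max_of_le_left (norm_nonneg S₁)) fun z => ?_
    rw [h, WithLp.prod_norm_eq_of_L1, mul_add]
    refine (norm_add_le _ _).trans (add_le_add ?_ ?_)
    · exact (S₁.le_opNorm _).trans (by gcongr; exact le_max_left _ _)
    · exact (S₂.le_opNorm _).trans (by gcongr; exact le_max_right _ _)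
  · refine S₁.opNorm_le_bound (norm_nonneg S) fun x => ?_
    have h1 := S.le_opNorm (WithLp.toLp 1 (x, 0))
    rw [h, WithLp.prod_norm_eq_of_L1] at h1
    simpa using h1
  · refine S₂.opNorm_le_bound (norm_nonneg S) fun y => ?_
    have h1 := S.le_opNorm (WithLp.toLp 1 (0, y))
    rw [h, WithLp.prod_norm_eq_of_L1] at h1
    simpa using h1

theorem exists_dual_eq_zero_and_ne_zero {M : Submodule ℝ Y} (hM : IsClosed (M : Set Y)) {y : Y}
    (hy : y ∉ M) : ∃ S : StrongDual ℝ Y, (∀ m ∈ M, S m = 0) ∧ S y ≠ 0 := by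
  obtain ⟨S, u, hu, hy⟩ := geometric_hahn_banach_closed_point M.convex hM hy
  have hu0 : 0 < u := by simpa using hu 0 M.zero_mem
  refine ⟨S, fun m hm => ?_, (hu0.trans hy).ne'⟩
  -- A linear form which is bounded above on a subspace vanishes there.
  by_contra h0
  have h1 := hu ((u / S m) • m) (M.smul_mem _ hm)
  rw [map_smul, smul_eq_mul, div_mul_cancel₀ _ h0] at h1
  exact h1.false

/-- A closed subspace of a reflexive space is reflexive. -/
theorem IsReflexive.of_isometry (hY : IsReflexive Y) (J : X →ₗᵢ[ℝ] Y)
    (hJ : IsClosed (Set.range J)) : IsReflexive X := by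
  intro F
  obtain ⟨y, hy⟩ := hY (F.comp ((ContinuousLinearMap.compL ℝ X Y ℝ).flip J.toContinuousLinearMap))
  have hF (S : StrongDual ℝ Y) : F (S.comp J.toContinuousLinearMap) = S y :=
    (DFunLike.congr_fun hy S).symm
  have hyJ : y ∈ LinearMap.range J.toLinearMap := by
    by_contra h
    obtain ⟨S, hS, hSy⟩ := exists_dual_eq_zero_and_ne_zero (M := LinearMap.range J.toLinearMap)
      (by rw [LinearMap.coe_range]; exact hJ) h
    refine hSy ?_
    have h0 : S.comp J.toContinuousLinearMap = 0 := by
      ext x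
      exact hS _ ⟨x, rfl⟩
    rw [← hF, h0, map_zero]
  obtain ⟨x, hx⟩ := hyJ
  refine ⟨x, ?_⟩
  ext T
  obtain ⟨S, hS, -⟩ := exists_extension_along_isometry J T
  have hST : S.comp J.toContinuousLinearMap = T := by
    ext x
    exact hS x
  rw [NormedSpace.dual_def, ← hST, hF, ← hx]
  rfl

theorem IsReflexive.withLp_one_prod (hX : IsReflexive X) (hY : IsReflexive Y) :
    IsReflexive (WithLp 1 (X × Y)) := by
  intro F
  set P₁ : WithLp 1 (X × Y) →L[ℝ] X := WithLp.fstL 1 ℝ X Y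
  set P₂ : WithLp 1 (X × Y) →L[ℝ] Y := WithLp.sndL 1 ℝ X Y
  obtain ⟨x, hx⟩ := hX (F.comp ((ContinuousLinearMap.compL ℝ _ X ℝ).flip P₁))
  obtain ⟨y, hy⟩ := hY (F.comp ((ContinuousLinearMap.compL ℝ _ Y ℝ).flip P₂))
  refine ⟨WithLp.toLp 1 (x, y), ?_⟩
  ext S
  obtain ⟨S₁, S₂, h⟩ := exists_apply_withLp_one_prod_eq S
  have hS : S = S₁.comp P₁ + S₂.comp P₂ := by
    ext z
    exact h z
  have h1 : S₁ x = F (S₁.comp P₁) := DFunLike.congr_fun hx S₁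
  have h2 : S₂ y = F (S₂.comp P₂) := DFunLike.congr_fun hy S₂
  rw [NormedSpace.dual_def, h, hS, map_add, ← h1, ← h2]
  rfl

end NormedSpace

/-- `L^p(μ, E)` is reflexive for `1 < p < ∞`: apply the Riesz representation theorem for `p` and
for the conjugate exponent `q`. -/
theorem isReflexive_Lp {α E : Type*} [MeasurableSpace α] {μ : Measure α} [SigmaFinite μ]
    [NormedAddCommGroup E] [InnerProductSpace ℝ E] [FiniteDimensional ℝ E] {p q : ℝ≥0∞}
    [Fact (1 ≤ p)] [hpq : ENNReal.HolderConjugate p q] (hp : p ≠ ∞) (hq : q ≠ ∞) :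
    IsReflexive (Lp E p μ) := by
  have hqp : ENNReal.HolderConjugate q p := hpq.symm
  have : Fact (1 ≤ q) := ⟨ENNReal.HolderConjugate.one_le q p⟩
  intro F
  obtain ⟨B, hB⟩ : ∃ B : Lp E q μ →L[ℝ] StrongDual ℝ (Lp E p μ),
      ∀ φ f, B φ f = ∫ x, inner ℝ (f x) (φ x) ∂μ :=
    ⟨((innerSL ℝ (E := E)).lpPairing μ p q).flip, fun φ f =>
      (innerSL ℝ (E := E)).lpPairing_eq_integral f φ⟩
  obtain ⟨f, -, hf⟩ := Lp.exists_forall_apply_eq_integral_inner (q := p) hq (F.comp B)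
  refine ⟨f, ?_⟩
  ext T
  obtain ⟨φ, -, hφ⟩ := Lp.exists_forall_apply_eq_integral_inner (q := q) hp T
  have hT : T = B φ := by
    ext f
    rw [hφ, hB]
  rw [NormedSpace.dual_def, hφ, hT]
  have h1 : F (B φ) = ∫ x, inner ℝ (φ x) (f x) ∂μ := hf φ
  rw [h1]
  exact integral_congr_ae (ae_of_all _ fun x => real_inner_comm _ _)

/-! ### The difference quotient -/

section DiffQuotient

variable {d : ℕ} {Ψ : ℝ≥0 → ℝ≥0} {p : ℝ≥0} {Ω : Set ℝ}

/-- The weighted difference quotient `(f(s₂) - f(s₁)) / (Ψ(|s₂ - s₁|) |s₂ - s₁|^(1/p))` at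
`z = (s₁, s₂)`. It vanishes by convention where `Ψ(|s₂ - s₁|) = 0`, whereas `psiRoot` is infinite
there unless `f(s₁) = f(s₂)`. -/
def diffQuotient (Ψ : ℝ≥0 → ℝ≥0) (p : ℝ≥0) (f : ℝ → EuclideanSpace ℝ (Fin d)) (z : ℝ × ℝ) :
    EuclideanSpace ℝ (Fin d) :=
  (1 / |z.2 - z.1| ^ (1 / (p : ℝ))) • (Ψ ‖z.2 - z.1‖₊ : ℝ)⁻¹ • (f z.2 - f z.1)

theorem enorm_diffQuotient (hp : 1 ≤ p) {f : ℝ → EuclideanSpace ℝ (Fin d)} {z : ℝ × ℝ}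
    (h : Ψ ‖z.2 - z.1‖₊ = 0 → f z.2 = f z.1) :
    ‖diffQuotient Ψ p f z‖ₑ = psiRoot Ψ p f z := by
  have hp0 : (0 : ℝ) < 1 / p := by
    have : (0 : ℝ) < p := by exact_mod_cast zero_lt_one.trans_le hp
    positivity
  rcases eq_or_ne (f z.2 - f z.1) 0 with h0 | h0
  · simp [diffQuotient, psiRoot, h0]
  have hΨ : Ψ ‖z.2 - z.1‖₊ ≠ 0 := fun hz => h0 (sub_eq_zero.2 (h hz))
  have hz : z.2 - z.1 ≠ 0 := fun hz => h0 (by rw [sub_eq_zero.1 hz, sub_self])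
  have h1 : ‖1 / |z.2 - z.1| ^ (1 / (p : ℝ))‖ₑ = (1 / ‖z.2 - z.1‖ₑ) ^ (1 / (p : ℝ)) := by
    have h3 : ‖|z.2 - z.1| ^ (1 / (p : ℝ))‖ₑ = ‖z.2 - z.1‖ₑ ^ (1 / (p : ℝ)) := by
      rw [← Real.norm_eq_abs, ← ofReal_norm, ← ofReal_norm (z.2 - z.1),
        ENNReal.ofReal_rpow_of_nonneg (norm_nonneg _) hp0.le, Real.norm_of_nonneg (by positivity)]
    have h4 : |z.2 - z.1| ^ (1 / (p : ℝ)) ≠ 0 :=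
      (Real.rpow_pos_of_pos (abs_pos.2 hz) _).ne'
    rw [one_div (|z.2 - z.1| ^ _), enorm_inv h4, h3, ENNReal.div_rpow_of_nonneg _ _ hp0.le,
      ENNReal.one_rpow]
    exact (one_div _).symm
  have h2 : ‖(Ψ ‖z.2 - z.1‖₊ : ℝ)⁻¹‖ₑ = (Ψ ‖z.2 - z.1‖₊ : ℝ≥0∞)⁻¹ := by
    rw [enorm_inv (by exact_mod_cast hΨ), NNReal.enorm_eq]
  rw [diffQuotient, psiRoot, enorm_smul, enorm_smul, h1, h2, mul_comm,
    ← ENNReal.div_eq_inv_mul]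

theorem eq_of_psiRoot_ne_top {f : ℝ → EuclideanSpace ℝ (Fin d)} {z : ℝ × ℝ}
    (h : psiRoot Ψ p f z ≠ ∞) (hΨ : Ψ ‖z.2 - z.1‖₊ = 0) : f z.2 = f z.1 := by
  by_contra h0
  refine h ?_
  have h1 : ‖f z.2 - f z.1‖ₑ ≠ 0 := enorm_ne_zero.2 (sub_ne_zero.2 h0)
  have h2 : (1 / ‖z.2 - z.1‖ₑ) ^ (1 / (p : ℝ)) ≠ 0 := by
    simp [ENNReal.rpow_eq_zero_iff]
  rw [psiRoot, hΨ, ENNReal.coe_zero, ENNReal.div_zero h1, ENNReal.top_mul h2]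

theorem aestronglyMeasurable_diffQuotient (hΨ : LebesgueMeasurable Ψ)
    {f : ℝ → EuclideanSpace ℝ (Fin d)} (hf : AEStronglyMeasurable f (volume.restrict Ω)) :
    AEStronglyMeasurable (diffQuotient Ψ p f) (volume.restrict (Ω ×ˢ Ω)) := by
  obtain ⟨h1, h2⟩ := aestronglyMeasurable_comp_fst_snd hf
  have h3 : AEMeasurable (fun z : ℝ × ℝ => (Ψ ‖z.2 - z.1‖₊ : ℝ)⁻¹) (volume.restrict (Ω ×ˢ Ω)) :=
    hΨ.comp_nnnorm_sub.coe_nnreal_real.restrict.inv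
  have h4 : Measurable (fun z : ℝ × ℝ => 1 / |z.2 - z.1| ^ (1 / (p : ℝ))) := by
    simp only [← Real.norm_eq_abs]
    fun_prop
  exact h4.aestronglyMeasurable.smul (h3.aestronglyMeasurable.smul (h2.sub h1))

theorem ae_fst_and_snd {P : ℝ → Prop} (h : ∀ᵐ s ∂(volume : Measure ℝ).restrict Ω, P s) :
    ∀ᵐ z ∂(volume : Measure (ℝ × ℝ)).restrict (Ω ×ˢ Ω), P z.1 ∧ P z.2 := by
  rw [Measure.volume_eq_prod, ← Measure.prod_restrict]
  exact (Measure.quasiMeasurePreserving_fst.ae h).and (Measure.quasiMeasurePreserving_snd.ae h)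

theorem diffQuotient_congr {f g : ℝ → EuclideanSpace ℝ (Fin d)}
    (h : f =ᵐ[volume.restrict Ω] g) :
    diffQuotient Ψ p f =ᵐ[volume.restrict (Ω ×ˢ Ω)] diffQuotient Ψ p g := by
  filter_upwards [ae_fst_and_snd h] with z hz
  rw [diffQuotient, diffQuotient, hz.1, hz.2]

theorem diffQuotient_add (f g : ℝ → EuclideanSpace ℝ (Fin d)) :
    diffQuotient Ψ p (f + g) = diffQuotient Ψ p f + diffQuotient Ψ p g := by
  ext1 z
  simp only [diffQuotient, Pi.add_apply, ← smul_add, add_sub_add_comm]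

theorem diffQuotient_smul (c : ℝ) (f : ℝ → EuclideanSpace ℝ (Fin d)) :
    diffQuotient Ψ p (c • f) = c • diffQuotient Ψ p f := by
  ext1 z
  simp only [diffQuotient, Pi.smul_apply, ← smul_sub, smul_comm c]

theorem psiSeminorm_eq_eLpNorm (hp : 1 ≤ p) {f : ℝ → EuclideanSpace ℝ (Fin d)}
    (h : ∀ᵐ z ∂(volume : Measure (ℝ × ℝ)).restrict (Ω ×ˢ Ω),
      Ψ ‖z.2 - z.1‖₊ = 0 → f z.2 = f z.1) :
    psiSeminorm Ψ p Ω f = eLpNorm (diffQuotient Ψ p f) p (volume.restrict (Ω ×ˢ Ω)) := by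
  have hp0 : p ≠ 0 := (zero_lt_one.trans_le hp).ne'
  rw [eLpNorm_eq_lintegral_rpow_enorm_toReal (by exact_mod_cast hp0) ENNReal.coe_ne_top,
    psiSeminorm, ENNReal.coe_toReal]
  congr 1
  refine lintegral_congr_ae ?_
  filter_upwards [h] with z hz
  rw [psiIntegrand_eq hp, enorm_diffQuotient hp hz]

/-- A function of finite seminorm is constant across the pairs at a distance where `Ψ` vanishes. -/
theorem ae_eq_of_psiSeminorm_lt_top (hp : 1 ≤ p) (hΨ : LebesgueMeasurable Ψ)
    {f : ℝ → EuclideanSpace ℝ (Fin d)} (hf : AEStronglyMeasurable f (volume.restrict Ω))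
    (h : psiSeminorm Ψ p Ω f < ∞) :
    ∀ᵐ z ∂(volume : Measure (ℝ × ℝ)).restrict (Ω ×ˢ Ω),
      Ψ ‖z.2 - z.1‖₊ = 0 → f z.2 = f z.1 := by
  have hp0 : (0 : ℝ) < p := by exact_mod_cast zero_lt_one.trans_le hp
  simp only [psiSeminorm, psiIntegrand_eq hp] at h
  have h1 : ∫⁻ z in Ω ×ˢ Ω, psiRoot Ψ p f z ^ (p : ℝ) ≠ ∞ := fun h2 => by
    rw [h2, ENNReal.top_rpow_of_pos (by positivity)] at h
    exact h.false
  filter_upwards [ae_lt_top' ((aemeasurable_psiRoot hΨ hf).pow_const _) h1] with z hz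
  refine eq_of_psiRoot_ne_top (p := p) fun h2 => ?_
  rw [h2, ENNReal.top_rpow_of_pos hp0] at hz
  exact hz.false

end DiffQuotient

/-! ### The isometric embedding of `W^{Ψ,p}` -/

namespace W

variable {Ψ : ℝ≥0 → ℝ≥0} {hΨ : LebesgueMeasurable Ψ} {p : ℝ≥0} [Fact (1 ≤ (p : ℝ≥0∞))]
  {Ω : Set ℝ} {d : ℕ}

theorem ae_eq_of_apply_eq_zero (f : W Ψ hΨ p Ω d) :
    ∀ᵐ z ∂(volume : Measure (ℝ × ℝ)).restrict (Ω ×ˢ Ω),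
      Ψ ‖z.2 - z.1‖₊ = 0 → f z.2 = f z.1 :=
  ae_eq_of_psiSeminorm_lt_top (one_le_of_fact p) hΨ (Lp.aestronglyMeasurable _)
    (psiSeminorm_lt_top f)

theorem psiSeminorm_eq (f : W Ψ hΨ p Ω d) :
    psiSeminorm Ψ p Ω f = eLpNorm (diffQuotient Ψ p f) p (volume.restrict (Ω ×ˢ Ω)) :=
  psiSeminorm_eq_eLpNorm (one_le_of_fact p) f.ae_eq_of_apply_eq_zero

theorem memLp_diffQuotient (f : W Ψ hΨ p Ω d) :
    MemLp (diffQuotient Ψ p f) p (volume.restrict (Ω ×ˢ Ω)) :=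
  ⟨aestronglyMeasurable_diffQuotient hΨ (Lp.aestronglyMeasurable _),
    f.psiSeminorm_eq ▸ psiSeminorm_lt_top f⟩

variable (Ψ hΨ p Ω d) in
/-- The isometric embedding `f ↦ (f, diffQuotient f)` of `W^{Ψ,p}(Ω, ℝ^d)` into the `ℓ¹` sum of
`L^p(Ω, ℝ^d)` and `L^p(Ω × Ω, ℝ^d)`. -/
def graph : W Ψ hΨ p Ω d →ₗᵢ[ℝ] WithLp 1 (LpOn p Ω d × LpOnProd p Ω d) where
  toFun f := WithLp.toLp 1 (toLp f, f.memLp_diffQuotient.toLp)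
  map_add' f g := by
    have h : (f + g).memLp_diffQuotient.toLp =
        f.memLp_diffQuotient.toLp + g.memLp_diffQuotient.toLp := by
      rw [← MemLp.toLp_add]
      refine MemLp.toLp_congr _ _ ?_
      rw [← diffQuotient_add, map_add]
      exact diffQuotient_congr (Lp.coeFn_add _ _)
    rw [h, map_add]
    rfl
  map_smul' c f := by
    have h : (c • f).memLp_diffQuotient.toLp = c • f.memLp_diffQuotient.toLp := by
      rw [← MemLp.toLp_const_smul]
      refine MemLp.toLp_congr _ _ ?_
      rw [← diffQuotient_smul, map_smul]
      exact diffQuotient_congr (Lp.coeFn_smul _ _)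
    rw [h, map_smul]
    rfl
  norm_map' f := by
    rw [norm_def, f.psiSeminorm_eq, ← Lp.norm_toLp _ f.memLp_diffQuotient]
    exact WithLp.prod_norm_eq_of_L1 _

theorem fst_graph (f : W Ψ hΨ p Ω d) : (graph Ψ hΨ p Ω d f).fst = toLp f := rfl

theorem coeFn_snd_graph (f : W Ψ hΨ p Ω d) :
    (graph Ψ hΨ p Ω d f).snd =ᵐ[volume.restrict (Ω ×ˢ Ω)] diffQuotient Ψ p f :=
  f.memLp_diffQuotient.coeFn_toLp

/-- The embedding has closed range: along a subsequence both components converge almost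
everywhere, so the second limit is the difference quotient of the first one, and the first one is
constant across the pairs where `Ψ` vanishes. -/
theorem isClosed_range_graph : IsClosed (Set.range (graph Ψ hΨ p Ω d)) := by
  refine IsSeqClosed.isClosed fun u y hu hy => ?_
  choose f hf using hu
  have h1 : Tendsto (fun n => toLp (f n)) atTop (𝓝 y.fst) := by
    have := ((WithLp.fstL 1 ℝ (LpOn p Ω d) (LpOnProd p Ω d)).continuous.tendsto y).comp hy
    refine this.congr fun n => ?_
    rw [Function.comp_apply, ← hf]
    rfl
  have h2 : Tendsto (fun n => (graph Ψ hΨ p Ω d (f n)).snd) atTop (𝓝 y.snd) := by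
    have := ((WithLp.sndL 1 ℝ (LpOn p Ω d) (LpOnProd p Ω d)).continuous.tendsto y).comp hy
    refine this.congr fun n => ?_
    rw [Function.comp_apply, ← hf]
    rfl
  obtain ⟨ns, hns, h3⟩ := Lp.exists_strictMono_tendsto_ae h1
  obtain ⟨ms, hms, h4⟩ := Lp.exists_strictMono_tendsto_ae (h2.comp hns.tendsto_atTop)
  have h5 : ∀ᵐ z ∂(volume : Measure (ℝ × ℝ)).restrict (Ω ×ˢ Ω),
      Tendsto (fun i => f (ns (ms i)) z.1) atTop (𝓝 (y.fst z.1)) ∧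
        Tendsto (fun i => f (ns (ms i)) z.2) atTop (𝓝 (y.fst z.2)) := by
    refine ae_fst_and_snd (P := fun x => Tendsto (fun i => f (ns (ms i)) x) atTop (𝓝 (y.fst x))) ?_
    filter_upwards [h3] with x hx
    exact hx.comp hms.tendsto_atTop
  have h6 : y.snd =ᵐ[volume.restrict (Ω ×ˢ Ω)] diffQuotient Ψ p y.fst := by
    filter_upwards [h4, h5, ae_all_iff.2 fun n => (f n).coeFn_snd_graph] with z hz hz' hf
    refine tendsto_nhds_unique hz ?_
    simp only [Function.comp_apply, hf]
    exact ((hz'.2.sub hz'.1).const_smul _).const_smul _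
  have h7 : ∀ᵐ z ∂(volume : Measure (ℝ × ℝ)).restrict (Ω ×ˢ Ω),
      Ψ ‖z.2 - z.1‖₊ = 0 → y.fst z.2 = y.fst z.1 := by
    filter_upwards [h5, ae_all_iff.2 fun n => (f n).ae_eq_of_apply_eq_zero] with z hz hf h0
    refine tendsto_nhds_unique hz.2 ?_
    simpa only [hf _ h0] using hz.1
  have h8 : psiSeminorm Ψ p Ω y.fst < ∞ := by
    rw [psiSeminorm_eq_eLpNorm (one_le_of_fact p) h7, ← eLpNorm_congr_ae h6]
    exact Lp.eLpNorm_lt_top _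
  set g : W Ψ hΨ p Ω d := ⟨y.fst, h8⟩
  refine ⟨g, ?_⟩
  have h9 : (graph Ψ hΨ p Ω d g).snd = y.snd := Lp.ext (g.coeFn_snd_graph.trans h6.symm)
  exact (WithLp.ofLp_injective 1) (Prod.ext rfl h9)

end W

end PsiSobolev

end

theorem proposition2p1 (Ω : Set ℝ) (hΩ : Ω.Nonempty) (d : ℕ)
    (Ψ : ℝ≥0 → ℝ≥0) (hΨ : PsiSobolev.LebesgueMeasurable Ψ)
    (p : ℝ≥0) [Fact (1 ≤ (p : ℝ≥0∞))] (q : ℝ≥0∞) (hpq : 1 / (p : ℝ≥0∞) + 1 / q = 1) :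
    (∀ T : StrongDual ℝ (PsiSobolev.W Ψ hΨ p Ω d),
      ∃ (φ : PsiSobolev.LpOn q Ω d) (ψ : PsiSobolev.LpOnProd q Ω d),
        ‖T‖ = max ‖φ‖ ‖ψ‖ ∧
        ∀ f : PsiSobolev.W Ψ hΨ p Ω d,
          T f = (∫ s in Ω, inner ℝ (f s) (φ s)) +
            ∫ z in Ω ×ˢ Ω,
              inner ℝ ((Ψ ‖z.2 - z.1‖₊ : ℝ)⁻¹ • (f z.2 - f z.1)) (ψ z) *
                (1 / |z.2 - z.1| ^ (1 / (p : ℝ)))) ∧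
    (1 < p → PsiSobolev.IsReflexive (PsiSobolev.W Ψ hΨ p Ω d)) := by
  have : ENNReal.HolderConjugate (p : ℝ≥0∞) q :=
    ENNReal.holderConjugate_iff.2 (by simpa only [one_div] using hpq)
  refine ⟨fun T => ?_, fun hp => ?_⟩
  · obtain ⟨S, hST, hS⟩ :=
      PsiSobolev.exists_extension_along_isometry (PsiSobolev.W.graph Ψ hΨ p Ω d) T
    obtain ⟨S₁, S₂, h⟩ := PsiSobolev.exists_apply_withLp_one_prod_eq S
    obtain ⟨φ, hφ, hφS⟩ := Lp.exists_forall_apply_eq_integral_inner (q := q) ENNReal.coe_ne_top S₁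
    obtain ⟨ψ, hψ, hψS⟩ := Lp.exists_forall_apply_eq_integral_inner (q := q) ENNReal.coe_ne_top S₂
    refine ⟨φ, ψ, ?_, fun f => ?_⟩
    · rw [← hS, PsiSobolev.norm_eq_max_of_apply_withLp_one_prod h, hφ, hψ]
    · rw [← hST, h, hφS, hψS, PsiSobolev.W.fst_graph]
      congr 1
      refine integral_congr_ae ?_
      filter_upwards [f.coeFn_snd_graph] with z hz
      rw [hz, PsiSobolev.diffQuotient, real_inner_smul_left, mul_comm]
  · have hq : q ≠ ∞ := by
      have hqp : ENNReal.HolderConjugate q (p : ℝ≥0∞) := this.symm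
      rw [ENNReal.HolderConjugate.ne_top_iff_ne_one q (p : ℝ≥0∞)]
      exact_mod_cast hp.ne'
    exact ((PsiSobolev.isReflexive_Lp (q := q) ENNReal.coe_ne_top hq).withLp_one_prod
      (PsiSobolev.isReflexive_Lp (q := q) ENNReal.coe_ne_top hq)).of_isometry
      (PsiSobolev.W.graph Ψ hΨ p Ω d) PsiSobolev.W.isClosed_range_graph
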